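/- **Proposition (Full period for bits).** Words are $w$-bit vectors, bit $0$ being the lowest; $\oplus$ is bitwise xor, $x\ll b$ the left shift by $b$ positions (discarding the bits shifted out), $\rho_r(x)$ the left rotation by $r$ positions, and sums and products of words are taken in $\mathbf Z/2^w\mathbf Z$. A state consists of $k$ words $s_0,\dots,s_{k-1}$, and has $n=kw$ bits. A generator consists of a next-state map (the linear engine) and an output map from states to words, which is applied to the current state. *Engines.* * xoroshiro with parameters $(a,b,c)$ and $k\ge 2$ words: with $y=s_0\oplus s_{k-1}$, the next state is $s'_{k-1}=\rho_c(y)$, $s'_{k-2}=\rho_a(s_0)\oplus y\oplus(y\ll b)$, and $s'_j=s_{j+1}$ for $0\le j<k-2$. * xoshiro with parameters $(a,b)$ and $4$ words: $s'_0=s_0\oplus s_1\oplus s_3$, $s'_1=s_0\oplus s_1\oplus s_2$, $s'_2=s_0\oplus s_2\oplus(s_1\ll a)$, $s'_3=\rho_b(s_1\oplus s_3)$. * xoshiro with parameters $(a,b)$ and $8$ words: $s'_0=s_0\oplus s_6$, $s'_1=s_0\oplus s_1\oplus s_2$, $s'_2=s_0\oplus s_2$, $s'_3=s_3\oplus s_4$,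 $s'_4=s_1\oplus s_4\oplus s_5$, $s'_5=s_1\oplus s_5$, $s'_6=s_3\oplus s_6\oplus s_7\oplus(s_1\ll a)$, $s'_7=\rho_b(s_3\oplus s_7)$. *Scramblers.* $+$ on words $p,q$ outputs $s_p+s_q$; $*$ on word $p$ outputs $s_pS$; $++$ on words $p,q$ (in this order) outputs $\rho_r(s_p+s_q)+s_p$; $**$ on word $p$ outputs $\rho_r(s_pS)\,T$. A generator without scrambler outputs a word of state, and any of the $k$ words may be chosen. *Generators with $w=64$* (the number in the name is $n$). The engine parameters are: xoroshiro128 $(24,16,37)$, except for xoroshiro128++, which uses $(49,21,28)$; xoshiro256 $(17,45)$; xoshiro512 $(11,21)$; xoroshiro1024 $(25,27,36)$. The generators are: * each of the four engines xoroshiro128, xoshiro256, xoshiro512, xoroshiro1024 without scrambler; * each of the four engines with $+$ on words $(0,1)$, $(0,3)$, $(0,2)$, $(0,15)$, respectively; * xoroshiro128 and xoroshiro1024 with $*$ on word $0$, $S=\mathtt{0x9e3779b97f4a7c13}$; * each of the four engines with $++$ on words $(0,1)$, $(0,3)$, $(2,0)$, $(15,0)$ with $r=17,23,17,23$, respectively;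 * each of the four engines with $**$ on word $0,1,1,0$, respectively, with $(S,r,T)=(5,7,9)$. *Generators with $w=32$.* The engine parameters are: xoroshiro64 $(26,9,13)$; xoshiro128 $(9,11)$. The generators are: * xoroshiro64 and xoshiro128 without scrambler; * xoroshiro64 with $*$ on word $0$, $S=\mathtt{0x9E3779BB}$; * xoshiro128 with $+$ on words $(0,3)$; * xoshiro128 with $++$ on words $(0,3)$, $r=7$; * xoroshiro64 with $**$ on word $0$, $(S,r,T)=(\mathtt{0x9E3779BB},5,5)$; * xoshiro128 with $**$ on word $1$, $(S,r,T)=(5,7,9)$. Then for each of these generators, for every initial state that is not identically zero, and for every $i$ with $0\le i<w$, the sequence of the $i$-th bits of the successive outputs has least positive period exactly $2^n-1$. -/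

import Mathlib

namespace Scrambled

/-- A state array of `k` words of `w` bits. -/
abbrev State (w k : ℕ) : Type := Fin k → BitVec w

/-- A pseudorandom number generator with `k * w` bits of state and `w` bits of output: a linear
engine, given by its next-state map, and a function computing the output from the current state. -/
structure Generator where
  w : ℕ
  k : ℕ
  next : State w k → State w k
  output : State w k → BitVec w

namespace Generator

/-- The number of bits of state. -/
def stateBits (g : Generator) : ℕ := g.k * g.w

/-- The sequence of values of the `i`-th output bit (bit `0` is the lowest one) starting from
`seed`; the first output is computed from `seed` itself. -/
def bitSeq (g : Generator) (i : Fin g.w) (seed : State g.w g.k) (t : ℕ) : Bool :=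
  (g.output (g.next^[t] seed)).getLsb i

end Generator

/-- `p` is the period (the least positive period) of the sequence `u`. -/
def HasPeriod {α : Type*} (u : ℕ → α) (p : ℕ) : Prop :=
  IsLeast {q : ℕ | 0 < q ∧ Function.Periodic u q} p

/-! ### Linear engines -/

/-- The xoroshiro engine with `k = m + 2` words: with `s₀` the first and `s₁` the last word and
`y = s₀ ^ s₁`, the last word becomes `rotl(y, c)`, the next-to-last one becomes
`rotl(s₀, a) ^ y ^ (y << b)`, and all the other words are shifted by one position. -/
def xoroshiro {w m : ℕ} (a b c : ℕ) (s : State w (m + 2)) : State w (m + 2) := fun j =>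
  let y : BitVec w := s 0 ^^^ s (Fin.last (m + 1))
  if j.val = m + 1 then y.rotateLeft c
  else if j.val = m then (s 0).rotateLeft a ^^^ y ^^^ (y <<< b)
  else s (j + 1)

/-- The xoshiro engine with four words. -/
def xoshiro4 {w : ℕ} (a b : ℕ) (s : State w 4) : State w 4 :=
  let t := s 1 <<< a
  let s2 := s 2 ^^^ s 0
  let s3 := s 3 ^^^ s 1
  let s1 := s 1 ^^^ s2
  let s0 := s 0 ^^^ s3
  ![s0, s1, s2 ^^^ t, s3.rotateLeft b]

/-- The xoshiro engine with eight words. -/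
def xoshiro8 {w : ℕ} (a b : ℕ) (s : State w 8) : State w 8 :=
  let t := s 1 <<< a
  let s2 := s 2 ^^^ s 0
  let s5 := s 5 ^^^ s 1
  let s1 := s 1 ^^^ s2
  let s7 := s 7 ^^^ s 3
  let s3 := s 3 ^^^ s 4
  let s4 := s 4 ^^^ s5
  let s0 := s 0 ^^^ s 6
  let s6 := s 6 ^^^ s7
  ![s0, s1, s2, s3, s4, s5, s6 ^^^ t, s7.rotateLeft b]

/-! ### Scramblers (arithmetic of `BitVec w` is modulo `2 ^ w`) -/

/-- No scrambler: the `j`-th word of state is emitted. -/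
def word {w k : ℕ} (j : Fin k) (s : State w k) : BitVec w := s j

/-- The `+` scrambler. -/
def plus {w k : ℕ} (p q : Fin k) (s : State w k) : BitVec w := s p + s q

/-- The `*` scrambler. -/
def star {w k : ℕ} (p : Fin k) (S : BitVec w) (s : State w k) : BitVec w := s p * S

/-- The `++` scrambler. -/
def plusPlus {w k : ℕ} (p q : Fin k) (r : ℕ) (s : State w k) : BitVec w :=
  (s p + s q).rotateLeft r + s p

/-- The `**` scrambler. -/
def starStar {w k : ℕ} (p : Fin k) (S : BitVec w) (r : ℕ) (T : BitVec w) (s : State w k) :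
    BitVec w :=
  (s p * S).rotateLeft r * T

/-! ### The generators -/

/-- The 64-bit generators. A linear engine used without a scrambler is listed once for each word
of state that can be emitted. -/
inductive Table64 : Generator → Prop
  | xoroshiro128 (j : Fin 2) : Table64 ⟨64, 2, xoroshiro 24 16 37, word j⟩
  | xoshiro256 (j : Fin 4) : Table64 ⟨64, 4, xoshiro4 17 45, word j⟩
  | xoshiro512 (j : Fin 8) : Table64 ⟨64, 8, xoshiro8 11 21, word j⟩
  | xoroshiro1024 (j : Fin 16) : Table64 ⟨64, 16, xoroshiro 25 27 36, word j⟩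
  | xoroshiro128plus : Table64 ⟨64, 2, xoroshiro 24 16 37, plus 0 1⟩
  | xoshiro256plus : Table64 ⟨64, 4, xoshiro4 17 45, plus 0 3⟩
  | xoshiro512plus : Table64 ⟨64, 8, xoshiro8 11 21, plus 0 2⟩
  | xoroshiro1024plus : Table64 ⟨64, 16, xoroshiro 25 27 36, plus 0 15⟩
  | xoroshiro128star : Table64 ⟨64, 2, xoroshiro 24 16 37, star 0 0x9e3779b97f4a7c13⟩
  | xoroshiro1024star : Table64 ⟨64, 16, xoroshiro 25 27 36, star 0 0x9e3779b97f4a7c13⟩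
  | xoroshiro128plusPlus : Table64 ⟨64, 2, xoroshiro 49 21 28, plusPlus 0 1 17⟩
  | xoshiro256plusPlus : Table64 ⟨64, 4, xoshiro4 17 45, plusPlus 0 3 23⟩
  | xoshiro512plusPlus : Table64 ⟨64, 8, xoshiro8 11 21, plusPlus 2 0 17⟩
  | xoroshiro1024plusPlus : Table64 ⟨64, 16, xoroshiro 25 27 36, plusPlus 15 0 23⟩
  | xoroshiro128starStar : Table64 ⟨64, 2, xoroshiro 24 16 37, starStar 0 5 7 9⟩
  | xoshiro256starStar : Table64 ⟨64, 4, xoshiro4 17 45, starStar 1 5 7 9⟩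
  | xoshiro512starStar : Table64 ⟨64, 8, xoshiro8 11 21, starStar 1 5 7 9⟩
  | xoroshiro1024starStar : Table64 ⟨64, 16, xoroshiro 25 27 36, starStar 0 5 7 9⟩

/-- The 32-bit generators, listed in the same way. -/
inductive Table32 : Generator → Prop
  | xoroshiro64 (j : Fin 2) : Table32 ⟨32, 2, xoroshiro 26 9 13, word j⟩
  | xoshiro128 (j : Fin 4) : Table32 ⟨32, 4, xoshiro4 9 11, word j⟩
  | xoroshiro64star : Table32 ⟨32, 2, xoroshiro 26 9 13, star 0 0x9E3779BB⟩
  | xoshiro128plus : Table32 ⟨32, 4, xoshiro4 9 11, plus 0 3⟩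
  | xoshiro128plusPlus : Table32 ⟨32, 4, xoshiro4 9 11, plusPlus 0 3 7⟩
  | xoroshiro64starStar : Table32 ⟨32, 2, xoroshiro 26 9 13, starStar 0 0x9E3779BB 5 5⟩
  | xoshiro128starStar : Table32 ⟨32, 4, xoshiro4 9 11, starStar 1 5 7 9⟩

end Scrambled

/-!
The engines are linear maps `T` on the space of states over the field with two elements, and the
proof has an algebraic and a counting part.

*Engines.* Let `n` be the number of bits of state. For each engine a polynomial `p` of degree `n` is
given such that `p(T) e = 0` for the state `e` with a single nonzero bit, and such that the residue
class of `X` modulo `p` has order `2 ^ n - 1` (`orderOf_root_of_primitiveCheck`). Since the residue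
ring has only `2 ^ n` elements, every nonzero residue class is then a power of `X`, hence
invertible. So the annihilator of `e` is generated by `p`, and `T ^ t e = e` exactly when
`2 ^ n - 1` divides `t` (`pow_apply_eq_self_iff`). The orbit of `e` therefore consists of all
nonzero states (`isFullCycle_of_iterate`). That `p` is the characteristic polynomial of `T`, or that
it is irreducible, need not be known.

*Computation.* The order is found from the factorization of `2 ^ n - 1` into prime divisors of
Fermat numbers, whose primality is established by Pratt certificates (`prime_of_prattCheck`). Powers
of `X` modulo `p` are computed by the kernel on natural numbers: a polynomial is encoded by
Kronecker substitution, giving each coefficient a slot of twelve bits, so that a product of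
polynomials is a product of numbers followed by a bitwise conjunction, and remainders are found by
Barrett reduction (`encodes_reduceMod`). The relation `p(T) e = 0` is verified by Horner's rule
(`annihilatesCheck`).

*Bits.* Each output function vanishes at the zero state and depends bijectively on one word of state
when the other words are fixed, so each of its bits equals `1` at exactly `2 ^ (n - 1)` states, all
of them nonzero (`card_getLsb_of_bijective`). If an output bit had a period smaller than
`2 ^ n - 1`, it would have a period that is a proper divisor `g` of `2 ^ n - 1`, and the odd number
`(2 ^ n - 1) / g` would divide the number `2 ^ (n - 1)` of ones (`IsFullCycle.hasPeriod`).
-/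

namespace Scrambled

open Polynomial

/-! ### Binary recursion arranged for evaluation by the kernel -/

/-- `force n f` is `f n`. The case distinction makes the kernel reduce `n` to a literal before it
substitutes it into `f`, so that iterated computations do not build up unevaluated terms. -/
def force {α : Type*} (n : ℕ) (f : ℕ → α) : α :=
  match n with
  | 0 => f 0
  | k + 1 => f (k + 1)

theorem force_eq {α : Type*} (n : ℕ) (f : ℕ → α) : force n f = f n := by
  cases n <;> rfl

/-- `tagForce tag n f` is `f n`, where `n` is forced together with `tag` as the number
`n * 2 ^ 64 + tag`. Lean hashes a natural number by its 64 lowest bits; these are nearly constant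
for the sparse numbers of Kronecker substitution, and without a tag the kernel's caches would
degenerate into lists. -/
def tagForce {α : Type*} (tag n : ℕ) (f : ℕ → α) : α :=
  force (n * 2 ^ 64 + tag % 2 ^ 64) fun s => f (s / 2 ^ 64)

theorem tagForce_eq {α : Type*} (tag n : ℕ) (f : ℕ → α) : tagForce tag n f = f n := by
  rw [tagForce, force_eq, Nat.mul_comm, Nat.mul_add_div (by norm_num),
    Nat.div_eq_of_lt (Nat.mod_lt _ (by norm_num)), add_zero]

/-- Reads the `k` lowest bits of `e` from the highest to the lowest one, starting from the
accumulator `a` and applying `step` to the accumulator and each bit. Horner's rule and binary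
exponentiation are both of this form. -/
def bitLoop (step : ℕ → Bool → ℕ) (e : ℕ) : ℕ → ℕ → ℕ
  | 0, a => a
  | i + 1, a => tagForce i (step a (e.testBit i)) (bitLoop step e i)

/-- The invariant `R t a` relates the accumulator `a` to the number `t` formed by the bits read so
far. -/
theorem bitLoop_spec {R : ℕ → ℕ → Prop} {step : ℕ → Bool → ℕ}
    (hs : ∀ t a b, R t a → R (2 * t + b.toNat) (step a b)) {e k a : ℕ} (h0 : R 0 a)
    (he : e < 2 ^ k) : R e (bitLoop step e k a) := by
  suffices H : ∀ i a, R (e >>> i) a → R e (bitLoop step e i a) by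
    apply H
    rwa [Nat.shiftRight_eq_div_pow, Nat.div_eq_of_lt he]
  intro i
  induction i with
  | zero => intro a h; simpa [bitLoop] using h
  | succ i ih =>
    intro a h
    rw [bitLoop, tagForce_eq]
    apply ih
    convert hs _ _ (e.testBit i) h using 1
    rw [Nat.testBit_eq_decide_div_mod_eq, Nat.shiftRight_eq_div_pow, Nat.shiftRight_eq_div_pow,
      pow_succ, ← Nat.div_div_eq_div_mul]
    rcases Nat.mod_two_eq_zero_or_one (e / 2 ^ i) with h | h <;> simp [h] <;> omega

/-! ### Primality certificates -/

/-- The residue of `a ^ e` modulo `p`, by binary exponentiation. -/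
def powMod (p a e : ℕ) : ℕ :=
  bitLoop (fun x b => x * x * (bif b then a else 1) % p) e (e.log2 + 1) 1

theorem powMod_cast (p a e : ℕ) : (powMod p a e : ZMod p) = (a : ZMod p) ^ e := by
  refine bitLoop_spec (R := fun t x => (x : ZMod p) = (a : ZMod p) ^ t) ?_ (by simp)
    Nat.lt_log2_self
  intro t x b h
  cases b <;> simp [h, pow_succ, two_mul, pow_add]

/-- The hypotheses of Lucas' primality test for `p` with witness `a`, where `l` lists the prime
divisors of `p - 1`. The exponent `16` suffices for every multiplicity that occurs below: it is only
used to see that `p - 1` has no prime divisor outside `l`. -/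
def lucasCheck (p a : ℕ) (l : List ℕ) : Bool :=
  (2 ≤ p) && (l.prod ^ 16 % (p - 1) == 0) && (powMod p a (p - 1) == 1) &&
    l.all fun q => powMod p a ((p - 1) / q) != 1

theorem powMod_lt {p : ℕ} (hp : 2 ≤ p) (a e : ℕ) : powMod p a e < p := by
  refine bitLoop_spec (R := fun _ x => x < p) ?_ (by omega) Nat.lt_log2_self
  intro t x b _
  exact Nat.mod_lt _ (by omega)

theorem prime_of_lucasCheck {p : ℕ} (a : ℕ) (l : List ℕ) (hl : ∀ q ∈ l, q.Prime)
    (h : lucasCheck p a l = true) : p.Prime := by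
  simp only [lucasCheck, Bool.and_eq_true, decide_eq_true_eq, beq_iff_eq, List.all_eq_true,
    bne_iff_ne] at h
  obtain ⟨⟨⟨hp, hd⟩, h1⟩, h2⟩ := h
  refine lucas_primality p a ?_ ?_
  · rw [← powMod_cast, h1, Nat.cast_one]
  · intro q hq hqd hpow
    have hql : q ∈ l := by
      have := hq.dvd_of_dvd_pow (hqd.trans (Nat.dvd_of_mod_eq_zero hd))
      obtain ⟨r, hr, hqr⟩ := (Prime.dvd_prod_iff hq.prime).1 this
      rwa [(Nat.prime_dvd_prime_iff_eq hq (hl r hr)).1 hqr]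
    apply h2 q hql
    rw [← powMod_cast] at hpow
    rw [← Nat.cast_one (R := ZMod p), ZMod.natCast_eq_natCast_iff'] at hpow
    rwa [Nat.mod_eq_of_lt (powMod_lt hp _ _), Nat.mod_eq_of_lt (by omega)] at hpow

/-- Checks a list of entries `(p, a, l)`, in which every member of `l` is `2` or the first component
of a later entry: `a` is a primitive root modulo `p`, and `l` lists the prime divisors of `p - 1`.
-/
def prattCheck : List (ℕ × ℕ × List ℕ) → Bool
  | [] => true
  | (p, a, l) :: t =>
    prattCheck t && lucasCheck p a l && l.all fun q => q == 2 || t.any fun c => c.1 == q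

theorem prime_of_prattCheck : ∀ {L : List (ℕ × ℕ × List ℕ)}, prattCheck L = true →
    ∀ c ∈ L, c.1.Prime
  | [], _ => by simp
  | (p, a, l) :: t, h => by
    simp only [prattCheck, Bool.and_eq_true, List.all_eq_true, Bool.or_eq_true, beq_iff_eq,
      List.any_eq_true] at h
    obtain ⟨⟨ht, hp⟩, hl⟩ := h
    have ih := prime_of_prattCheck ht
    refine List.forall_mem_cons.2 ⟨prime_of_lucasCheck a l (fun q hq => ?_) hp, ih⟩
    obtain rfl | ⟨c, hc, rfl⟩ := hl q hq
    exacts [Nat.prime_two, ih c hc]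

/-- Pratt certificates for the prime divisors of `2 ^ 1024 - 1`, together with the smaller primes on
which they depend. -/
def prattCertificates : List (ℕ × ℕ × List ℕ) :=
  [
   (741640062627530801524787141901937474059940781097519023905821316144415759504705008092818711693940737, 3, [2, 1129, 26813, 40644377, 17338437577121, 16975143302271505426897585653131126520182328037821729720833840187223]),
   (16975143302271505426897585653131126520182328037821729720833840187223, 3, [2, 3, 13, 1531, 173897, 1746751, 12088361983, 1392542208042011209, 3088888502468305782559]),
   (93461639715357977769163558199606896584051237541638188580280321, 43, [2, 3, 5, 7, 13, 31618624099079, 1057372046781162536274034354686893329625329]),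
   (7455602825647884208337395736200454918783366342657, 3, [2, 19, 47, 82488781, 1143290228161321, 43226490359557706629]),
   (1057372046781162536274034354686893329625329, 11, [2, 3, 8861, 10608557, 25353082741699, 9243081088796207]),
   (5704689200685129054721, 21, [2, 3, 5, 12497, 733803839347]),
   (3088888502468305782559, 3, [2, 3, 59, 163, 53531740710344629]),
   (43226490359557706629, 6, [2, 3, 7, 514601075709020317]),
   (1392542208042011209, 11, [2, 3, 7, 13, 7871739519977]),
   (514601075709020317, 5, [2, 3, 594163, 72174509311]),
   (59649589127497217, 3, [2, 116503103764643]), (53531740710344629, 2, [2, 3, 31, 47967509597083]),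
   (9243081088796207, 5, [2, 20939, 220714482277]), (1238926361552897, 3, [2, 157, 3853149761]),
   (1143290228161321, 26, [2, 3, 5, 29, 101, 1084262953]),
   (116503103764643, 2, [2, 7, 449, 18533742247]), (67280421310721, 3, [2, 5, 47, 373, 2998279]),
   (47967509597083, 2, [2, 3, 191, 41856465617]), (31618624099079, 17, [2, 1789, 10079, 876769]),
   (25353082741699, 2, [2, 3, 16879, 83447159]), (17338437577121, 3, [2, 5, 11, 1217, 8094811]),
   (7871739519977, 3, [2, 26041, 37785317]), (733803839347, 2, [2, 3, 2203, 55515497]),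
   (220714482277, 5, [2, 3, 6130957841]), (72174509311, 3, [2, 3, 5, 11299, 212923]),
   (41856465617, 3, [2, 7, 487, 15661]), (18533742247, 6, [2, 3, 181, 1896229]),
   (12088361983, 6, [2, 3, 19, 37, 2865899]), (6130957841, 3, [2, 5, 7, 10948139]),
   (3853149761, 6, [2, 5, 719, 16747]), (1084262953, 5, [2, 3, 45177623]),
   (83447159, 11, [2, 41723579]), (82488781, 2, [2, 3, 5, 11, 1543]), (55515497, 3, [2, 6939437]),
   (45177623, 5, [2, 7, 47, 68659]), (41723579, 2, [2, 13, 1604753]),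
   (40644377, 3, [2, 71, 163, 439]), (37785317, 2, [2, 9446329]), (10948139, 2, [2, 23, 29, 283]),
   (10608557, 2, [2, 7, 223, 1699]), (9446329, 17, [2, 3, 101, 433]),
   (8094811, 3, [2, 3, 5, 47, 5741]), (6939437, 2, [2, 7, 139, 1783]), (6700417, 5, [2, 3, 17449]),
   (2998279, 3, [2, 3, 166571]), (2865899, 2, [2, 7, 204707]), (2424833, 3, [2, 37]),
   (1896229, 2, [2, 3, 52673]), (1746751, 3, [2, 3, 5, 17, 137]), (1604753, 3, [2, 100297]),
   (876769, 7, [2, 3, 9133]), (594163, 2, [2, 3, 11003]), (274177, 5, [2, 3, 7, 17]),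
   (212923, 3, [2, 3, 3943]), (204707, 2, [2, 19, 5387]), (173897, 3, [2, 21737]),
   (166571, 2, [2, 5, 16657]), (100297, 13, [2, 3, 7, 199]), (68659, 2, [2, 3, 11443]),
   (65537, 3, [2]), (52673, 3, [2, 823]), (26813, 2, [2, 6703]), (26041, 13, [2, 3, 5, 7, 31]),
   (21737, 6, [2, 11, 13, 19]), (20939, 2, [2, 19, 29]), (17449, 14, [2, 3, 727]),
   (16879, 3, [2, 3, 29, 97]), (16747, 2, [2, 3, 2791]), (16657, 5, [2, 3, 347]),
   (15661, 2, [2, 3, 5, 29]), (12497, 3, [2, 11, 71]), (11443, 2, [2, 3, 1907]),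
   (11299, 3, [2, 3, 7, 269]), (11003, 2, [2, 5501]), (10079, 11, [2, 5039]),
   (9133, 6, [2, 3, 761]), (8861, 2, [2, 5, 443]), (6703, 5, [2, 3, 1117]),
   (5741, 2, [2, 5, 7, 41]), (5501, 2, [2, 5, 11]), (5387, 2, [2, 2693]), (5039, 11, [2, 11, 229]),
   (3943, 3, [2, 3, 73]), (2791, 6, [2, 3, 5, 31]), (2693, 2, [2, 673]), (2203, 5, [2, 3, 367]),
   (1907, 2, [2, 953]), (1789, 6, [2, 3, 149]), (1783, 10, [2, 3, 11]), (1699, 3, [2, 3, 283]),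
   (1543, 5, [2, 3, 257]), (1531, 2, [2, 3, 5, 17]), (1217, 3, [2, 19]), (1129, 11, [2, 3, 47]),
   (1117, 2, [2, 3, 31]), (953, 3, [2, 7, 17]), (823, 3, [2, 3, 137]), (761, 6, [2, 5, 19]),
   (727, 5, [2, 3, 11]), (719, 11, [2, 359]), (673, 5, [2, 3, 7]), (641, 3, [2, 5]),
   (487, 3, [2, 3]), (449, 3, [2, 7]), (443, 2, [2, 13, 17]), (439, 15, [2, 3, 73]),
   (433, 5, [2, 3]), (373, 2, [2, 3, 31]), (367, 6, [2, 3, 61]), (359, 7, [2, 179]),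
   (347, 2, [2, 173]), (283, 3, [2, 3, 47]), (269, 2, [2, 67]), (257, 3, [2]), (229, 6, [2, 3, 19]),
   (223, 3, [2, 3, 37]), (199, 3, [2, 3, 11]), (191, 19, [2, 5, 19]), (181, 2, [2, 3, 5]),
   (179, 2, [2, 89]), (173, 2, [2, 43]), (163, 2, [2, 3]), (157, 5, [2, 3, 13]), (149, 2, [2, 37]),
   (139, 2, [2, 3, 23]), (137, 3, [2, 17]), (101, 2, [2, 5]), (97, 5, [2, 3]), (89, 3, [2, 11]),
   (73, 5, [2, 3]), (71, 7, [2, 5, 7]), (67, 2, [2, 3, 11]), (61, 2, [2, 3, 5]), (59, 2, [2, 29]),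
   (47, 5, [2, 23]), (43, 3, [2, 3, 7]), (41, 6, [2, 5]), (37, 2, [2, 3]), (31, 3, [2, 3, 5]),
   (29, 2, [2, 7]), (23, 5, [2, 11]), (19, 2, [2, 3]), (17, 3, [2]), (13, 2, [2, 3]),
   (11, 2, [2, 5]), (7, 3, [2, 3]), (5, 2, [2]), (3, 2, [2])]

theorem prattCheck_prattCertificates : prattCheck prattCertificates = true := by
  decide +kernel

/-! ### Arithmetic modulo a binary polynomial by Kronecker substitution -/

/-- Twelve bits are reserved for each coefficient. The sums of products formed during reduction
modulo a polynomial of degree at most `1024` have coefficients at most `2048`, so that there are no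
carries between slots. -/
abbrev slot : ℕ := 2 ^ 12

/-- The number whose `m` lowest slots are `1`: a bitwise conjunction with it reduces each
coefficient modulo `2`. -/
def mask (m : ℕ) : ℕ := (slot ^ m - 1) / (slot - 1)

theorem mask_eq_sum (m : ℕ) : mask m = ∑ i ∈ Finset.range m, slot ^ i :=
  (Nat.geomSum_eq (by norm_num) m).symm

theorem land_slot_step {u v c : ℕ} (hc : c < slot) :
    (c + slot * u) &&& (1 + slot * v) = c % 2 + slot * (u &&& v) := by
  have h1 : 1 < slot := by norm_num
  have h2 : c % 2 < slot := by omega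
  refine Nat.eq_of_testBit_eq fun i => ?_
  rw [add_comm c, add_comm 1, add_comm (c % 2), Nat.testBit_and,
    Nat.testBit_two_pow_mul_add _ hc, Nat.testBit_two_pow_mul_add _ h1,
    Nat.testBit_two_pow_mul_add _ h2]
  split_ifs
  · rw [← Nat.and_one_is_mod, Nat.testBit_and]
  · rw [Nat.testBit_and]

theorem sum_land_mask (c : ℕ → ℕ) (hc : ∀ i, c i < slot) (m : ℕ) :
    (∑ i ∈ Finset.range m, c i * slot ^ i) &&& mask m =
      ∑ i ∈ Finset.range m, c i % 2 * slot ^ i := by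
  rw [mask_eq_sum]
  induction m generalizing c with
  | zero => simp
  | succ m ih =>
    have key (d : ℕ → ℕ) : ∑ i ∈ Finset.range (m + 1), d i * slot ^ i =
        d 0 + slot * ∑ i ∈ Finset.range m, d (i + 1) * slot ^ i := by
      rw [Finset.sum_range_succ', Finset.mul_sum, add_comm]
      congr 1
      · simp
      · exact Finset.sum_congr rfl fun i _ => by ring
    have h1 := key fun _ => 1
    simp only [one_mul] at h1
    rw [key, h1, land_slot_step (hc 0), ih _ fun i => hc (i + 1), key fun i => c i % 2]

section

variable {A : Type*} [CommRing A]

/-- `a` is the Kronecker encoding of a polynomial of degree less than `m` with coefficients `0` and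
`1`, whose value at `x` is `y`. -/
def Encodes (x : A) (m a : ℕ) (y : A) : Prop :=
  ∃ c : ℕ → ℕ, (∀ i, c i ≤ 1) ∧ a = ∑ i ∈ Finset.range m, c i * slot ^ i ∧
    y = ∑ i ∈ Finset.range m, (c i : A) * x ^ i

theorem Encodes.exists_poly {x : A} {m a : ℕ} {y : A} (h : Encodes x m a y) (hm : 0 < m) :
    ∃ p : ℕ[X], (∀ i, p.coeff i ≤ 1) ∧ p.natDegree < m ∧ p.eval slot = a ∧ aeval x p = y := by
  obtain ⟨c, hc, rfl, rfl⟩ := h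
  refine ⟨∑ i ∈ Finset.range m, C (c i) * X ^ i, fun i => ?_, ?_, ?_, ?_⟩
  · rw [finsetSum_coeff]
    simp only [coeff_C_mul, coeff_X_pow, mul_ite, mul_one, mul_zero]
    rw [Finset.sum_ite_eq]
    split_ifs
    exacts [hc i, zero_le_one]
  · rw [Nat.lt_iff_le_pred hm]
    refine natDegree_sum_le_of_forall_le _ _ fun i hi => ?_
    refine (natDegree_C_mul_X_pow_le _ _).trans ?_
    have := Finset.mem_range.1 hi
    omega
  · simp [eval_finsetSum]
  · simp

/-- Whatever the number `a` is, masking it gives the encoding of something; this is all that has to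
be known about the quotients in `reduceMod`. -/
theorem exists_encodes_land_mask (x : A) (a m : ℕ) : ∃ y, Encodes x m (a &&& mask m) y := by
  have H : ∀ m a : ℕ, ∃ c : ℕ → ℕ, (∀ i, c i ≤ 1) ∧
      a &&& mask m = ∑ i ∈ Finset.range m, c i * slot ^ i := by
    intro m
    induction m with
    | zero => exact fun a => ⟨fun _ => 0, by simp, by simp [mask]⟩
    | succ m ih =>
      intro a
      obtain ⟨c, hc, h⟩ := ih (a / slot)
      refine ⟨fun i => Nat.casesOn i (a % slot % 2) c, ?_, ?_⟩
      · rintro (_ | i)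
        · exact Nat.le_of_lt_succ (Nat.mod_lt _ two_pos)
        · exact hc i
      · have h1 : mask (m + 1) = 1 + slot * mask m := by
          rw [mask_eq_sum, mask_eq_sum, Finset.sum_range_succ', Finset.mul_sum, add_comm]
          simp [pow_succ']
        rw [h1, ← Nat.mod_add_div a slot, land_slot_step (Nat.mod_lt _ (by norm_num)),
          Nat.mod_add_div a slot, h, Finset.sum_range_succ', Finset.mul_sum, add_comm]
        simp only [pow_zero, mul_one, pow_succ']
        congr 1
        exact Finset.sum_congr rfl fun i _ => by ring
  obtain ⟨c, hc, h⟩ := H m a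
  exact ⟨_, c, hc, h, rfl⟩

theorem Encodes.of_lt {x : A} {m n a : ℕ} {y : A} (h : Encodes x m a y) (hnm : n ≤ m)
    (ha : a < slot ^ n) : Encodes x n a y := by
  obtain ⟨c, hc, rfl, rfl⟩ := h
  have h0 : ∀ i ∈ Finset.range m, i ∉ Finset.range n → c i = 0 := by
    intro i hi hin
    by_contra hne
    have h1 : c i * slot ^ i ≤ ∑ i ∈ Finset.range m, c i * slot ^ i :=
      Finset.single_le_sum (f := fun i => c i * slot ^ i) (fun _ _ => Nat.zero_le _) hi
    have h2 : slot ^ n ≤ slot ^ i :=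
      Nat.pow_le_pow_right (by norm_num) (by simpa using hin)
    have h3 : 1 * slot ^ i ≤ c i * slot ^ i := Nat.mul_le_mul_right _ (by omega)
    omega
  have hs : Finset.range n ⊆ Finset.range m := Finset.range_mono hnm
  refine ⟨c, hc, (Finset.sum_subset hs fun i hi hn => by rw [h0 i hi hn, zero_mul]).symm,
    (Finset.sum_subset hs fun i hi hn => by rw [h0 i hi hn, Nat.cast_zero, zero_mul]).symm⟩

theorem coeff_mul_le {p q : ℕ[X]} {m : ℕ} (hp : ∀ i, p.coeff i ≤ 1) (hq : ∀ i, q.coeff i ≤ 1)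
    (hm : p.natDegree < m) (k : ℕ) : (p * q).coeff k ≤ m := by
  rw [coeff_mul, Finset.Nat.sum_antidiagonal_eq_sum_range_succ (fun i j => p.coeff i * q.coeff j)]
  calc _ ≤ ∑ i ∈ Finset.range (k + 1), if i < m then 1 else 0 := by
        refine Finset.sum_le_sum fun i _ => ?_
        split_ifs with h
        · exact Nat.mul_le_mul (hp _) (hq _)
        · rw [coeff_eq_zero_of_natDegree_lt (by omega), zero_mul]
    _ ≤ m := by
        rw [← Finset.card_filter]
        calc _ ≤ (Finset.range m).card := Finset.card_le_card fun i hi => by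
              simpa using (Finset.mem_filter.1 hi).2
          _ = m := Finset.card_range m

variable [CharP A 2]

theorem encodes_land_mask (x : A) {p : ℕ[X]} {m : ℕ} (hp : ∀ i, p.coeff i < slot)
    (hm : p.natDegree < m) : Encodes x m (p.eval slot &&& mask m) (aeval x p) := by
  refine ⟨fun i => p.coeff i % 2, fun i => Nat.le_of_lt_succ (Nat.mod_lt _ two_pos), ?_, ?_⟩
  · rw [eval_eq_sum_range' hm, sum_land_mask _ hp]
  · rw [aeval_eq_sum_range' hm]
    refine Finset.sum_congr rfl fun i _ => ?_
    rw [nsmul_eq_mul]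
    congr 1
    rw [CharP.natCast_eq_natCast A 2]
    exact (Nat.mod_modEq _ _).symm

/-- Barrett reduction of the encoding `c` modulo the polynomial encoded by `P`, of degree `n`. The
quotient is computed from `mu`, the encoding of the quotient of `X ^ (2 * n)` by that polynomial.
Over the field with two elements the remainder is `c` plus the quotient times `P`. A wrong `mu`
would still give a representative of the same residue class, but in general one of too large a
degree. -/
def reduceMod (n P mu maskn mask2n c : ℕ) : ℕ :=
  (c + (((c &&& mask2n) >>> (12 * n) * mu) >>> (12 * n) &&& maskn) * P) &&& mask2n

theorem encodes_reduceMod {x : A} {n P a : ℕ} {y : A} (mu : ℕ) (hn : 0 < n) (hn' : n ≤ 1024)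
    (hP : Encodes x (n + 1) P 0) (ha : Encodes x n a y) (b : Bool) :
    Encodes x (2 * n)
      (reduceMod n P mu (mask n) (mask (2 * n)) (a * a * slot ^ b.toNat))
      (y * y * x ^ b.toNat) := by
  obtain ⟨z, hz⟩ := exists_encodes_land_mask x
    (((a * a * slot ^ b.toNat &&& mask (2 * n)) >>> (12 * n) * mu) >>> (12 * n)) n
  obtain ⟨p, hp1, hpn, hpe, hpx⟩ := ha.exists_poly hn
  obtain ⟨q, hq1, hqn, hqe, hqx⟩ := hz.exists_poly hn
  obtain ⟨r, hr1, hrn, hre, hrx⟩ := hP.exists_poly n.succ_pos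
  convert encodes_land_mask x (p := p * p * X ^ b.toNat + q * r) (m := 2 * n) ?_ ?_ using 1
  · simp only [reduceMod, eval_add, eval_mul, eval_pow, eval_X, hpe, hqe, hre]
  · simp [hpx, hrx]
  · intro i
    rw [coeff_add, coeff_mul_X_pow']
    have h1 := coeff_mul_le hq1 hr1 hqn i
    have h2 := coeff_mul_le hp1 hp1 hpn (i - b.toNat)
    have : slot = 4096 := by norm_num
    split_ifs <;> omega
  · have h1 := natDegree_mul_le (p := p * p) (q := X ^ b.toNat)
    have h2 := natDegree_mul_le (p := p) (q := p)
    have h3 := natDegree_mul_le (p := q) (q := r)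
    have h4 := natDegree_X_pow_le (R := ℕ) b.toNat
    have h5 := natDegree_add_le (p * p * X ^ b.toNat) (q * r)
    have h6 := b.toNat_le
    omega

/-- The encoding of `x ^ e` modulo the polynomial encoded by `P`. Once a remainder fails to have
degree less than `n`, it is returned unchanged; then the result is at least `slot ^ n`. -/
def powX (n P mu maskn mask2n e : ℕ) : ℕ :=
  bitLoop (fun a b => bif Nat.blt a (slot ^ n) then
    reduceMod n P mu maskn mask2n (a * a * bif b then slot else 1) else a)
    e (e.log2 + 1) 1

theorem encodes_powX {x : A} {n P : ℕ} (mu : ℕ) (hn : 0 < n) (hn' : n ≤ 1024)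
    (hP : Encodes x (n + 1) P 0) (e : ℕ) (h : powX n P mu (mask n) (mask (2 * n)) e < slot ^ n) :
    Encodes x n (powX n P mu (mask n) (mask (2 * n)) e) (x ^ e) := by
  revert h
  refine bitLoop_spec (R := fun t a => a < slot ^ n → Encodes x n a (x ^ t)) ?_ ?_ Nat.lt_log2_self
  · intro t a b ih h
    rcases lt_or_ge a (slot ^ n) with ha | ha
    · have hb : Nat.blt a (slot ^ n) = true := by simpa using ha
      rw [hb, cond_true] at h ⊢
      have := (encodes_reduceMod mu hn hn' hP (ih ha) b)
      rw [← pow_add, ← pow_add, ← two_mul] at this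
      cases b <;> simpa using this.of_lt (by omega) (by simpa using h)
    · have hb : Nat.blt a (slot ^ n) = false := by
        rw [Bool.eq_false_iff, Ne, Nat.blt_eq]; omega
      rw [hb, cond_false] at h
      omega
  · intro _
    refine ⟨fun i => if i = 0 then 1 else 0, fun i => by grind, ?_, ?_⟩ <;>
      simp [hn.ne']

end

/-! ### The order of the residue class of `X` -/

/-- The value at `x` of the polynomial whose coefficients are the `m` lowest bits of `t`. -/
def bitEval {S : Type*} [Semiring S] (x : S) (m t : ℕ) : S :=
  ∑ i ∈ Finset.range m, ((t.testBit i).toNat : S) * x ^ i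

theorem bitEval_succ {S : Type*} [Semiring S] (x : S) (m t : ℕ) (b : Bool) :
    bitEval x (m + 1) (2 * t + b.toNat) = x * bitEval x m t + (b.toNat : S) := by
  have h0 : (2 * t + b.toNat).testBit 0 = b := by cases b <;> simp [Nat.testBit_zero]
  have hs (i : ℕ) : (2 * t + b.toNat).testBit (i + 1) = t.testBit i := by
    rw [Nat.testBit_succ]
    congr 1
    have := b.toNat_le
    omega
  rw [bitEval, Finset.sum_range_succ', h0, bitEval, Finset.mul_sum, pow_zero, mul_one]
  congr 1
  refine Finset.sum_congr rfl fun i _ => ?_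
  rw [hs, pow_succ', ← mul_assoc, ← mul_assoc, Nat.cast_comm]

theorem map_bitEval {S S' F : Type*} [Semiring S] [Semiring S'] [FunLike F S S']
    [RingHomClass F S S'] (f : F) (x : S) (m t : ℕ) :
    f (bitEval x m t) = bitEval (f x) m t := by
  simp [bitEval]

/-- If `step` implements, through the interpretation `v` of the accumulator, the recursion that a
quantity `u m t` depending on the `m` lowest bits of `t` satisfies when a lowest bit is appended,
then `bitLoop` computes this quantity. -/
theorem bitLoop_eq_of_horner {M : Type*} (v : ℕ → M) (u : ℕ → ℕ → M) {step : ℕ → Bool → ℕ}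
    (h0 : v 0 = u 0 0)
    (hu : ∀ m, u m 0 = u 0 0)
    (hs : ∀ m t a b, v a = u m t → v (step a b) = u (m + 1) (2 * t + b.toNat))
    {m t : ℕ} (ht : t < 2 ^ m) : v (bitLoop step t m 0) = u m t := by
  refine bitLoop_spec (R := fun t a => ∀ m, t < 2 ^ m → v a = u m t) ?_ ?_ ht m ht
  · rintro t a b ih (_ | m) hm
    · obtain ⟨rfl, hb⟩ : t = 0 ∧ b.toNat = 0 := by omega
      rw [hs 0 0 a b (ih 0 (by norm_num)), hb, hu, hu]
    · exact hs m t a b (ih m (by have := b.toNat_le; omega))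
  · exact fun m _ => by rw [h0, hu m]

theorem bitEval_zero {S : Type*} [Semiring S] (x : S) (m : ℕ) : bitEval x m 0 = 0 := by
  simp [bitEval]

/-- The Kronecker encoding of the polynomial whose coefficients are the bits of `t`. -/
def spread (m t : ℕ) : ℕ :=
  bitLoop (fun a b => slot * a + b.toNat) t m 0

theorem spread_eq {m t : ℕ} (ht : t < 2 ^ m) : spread m t = bitEval slot m t :=
  bitLoop_eq_of_horner id (bitEval slot) (bitEval_zero _ _).symm
    (fun _ => by simp only [bitEval_zero])
    (fun m t a b h => by rw [bitEval_succ, ← h]; rfl) ht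

theorem encodes_spread {A : Type*} [CommRing A] (x : A) {m t : ℕ} (ht : t < 2 ^ m) :
    Encodes x m (spread m t) (bitEval x m t) :=
  ⟨fun i => (t.testBit i).toNat, fun _ => Bool.toNat_le _, spread_eq ht, rfl⟩

/-- The polynomial over the field with two elements whose coefficients are the bits of `P`; its
degree is `n` if `2 ^ n ≤ P < 2 ^ (n + 1)`. -/
noncomputable def bitPoly (n P : ℕ) : (ZMod 2)[X] := bitEval X (n + 1) P

theorem degree_sum_lt (n : ℕ) (c : ℕ → ℕ) :
    (∑ i ∈ Finset.range n, (c i : (ZMod 2)[X]) * X ^ i).degree < (n : WithBot ℕ) := by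
  refine (degree_sum_le _ _).trans_lt ((Finset.sup_lt_iff (WithBot.bot_lt_coe n)).2 fun i hi => ?_)
  rw [← C_eq_natCast]
  exact (degree_C_mul_X_pow_le i _).trans_lt (WithBot.coe_lt_coe.2 (Finset.mem_range.1 hi))

theorem bitPoly_eq {n P : ℕ} (h1 : 2 ^ n ≤ P) (h2 : P < 2 ^ (n + 1)) :
    ∃ r : (ZMod 2)[X], r.degree < n ∧ bitPoly n P = X ^ n + r := by
  refine ⟨_, degree_sum_lt n fun i => (P.testBit i).toNat, ?_⟩
  have : P.testBit n = true := by
    rw [Nat.testBit_eq_decide_div_mod_eq, Nat.div_eq_of_lt_le (k := 1)] <;> simp_all [pow_succ]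
    omega
  rw [bitPoly, bitEval, Finset.sum_range_succ, this, add_comm]
  simp

theorem monic_bitPoly {n P : ℕ} (h1 : 2 ^ n ≤ P) (h2 : P < 2 ^ (n + 1)) :
    (bitPoly n P).Monic := by
  obtain ⟨r, hr, h⟩ := bitPoly_eq h1 h2
  rw [h]
  exact monic_X_pow_add hr

theorem degree_bitPoly {n P : ℕ} (h1 : 2 ^ n ≤ P) (h2 : P < 2 ^ (n + 1)) :
    (bitPoly n P).degree = n := by
  obtain ⟨r, hr, h⟩ := bitPoly_eq h1 h2
  rw [h, degree_add_eq_left_of_degree_lt] <;> simp [hr]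

theorem Encodes.eq_one {p : (ZMod 2)[X]} {n a : ℕ} (hp : p.degree = n) (hn : 0 < n)
    (h : Encodes (AdjoinRoot.root p) n a 1) : a = 1 := by
  obtain ⟨c, hc, rfl, hy⟩ := h
  have hmk : AdjoinRoot.mk p (∑ i ∈ Finset.range n, (c i : (ZMod 2)[X]) * X ^ i - 1) = 0 := by
    rw [map_sub, map_one, hy, map_sum, sub_eq_zero]
    simp
  rw [AdjoinRoot.mk_eq_zero] at hmk
  have h0 := eq_zero_of_dvd_of_degree_lt hmk (by
    rw [hp]
    refine (degree_sub_le _ _).trans_lt (max_lt (degree_sum_lt n c) ?_)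
    rw [degree_one]
    exact_mod_cast hn)
  have hcoeff : ∀ i < n, c i = if i = 0 then 1 else 0 := by
    intro i hi
    have := congrArg (fun q => coeff q i) (sub_eq_zero.1 h0)
    simp only [finsetSum_coeff, ← C_eq_natCast, coeff_C_mul, coeff_X_pow, coeff_one, mul_ite,
      mul_one, mul_zero, Finset.sum_ite_eq, Finset.mem_range, hi, if_true] at this
    have h1 := hc i
    interval_cases c i <;> split_ifs at this ⊢ <;> simp_all
  rw [Finset.sum_congr rfl fun i hi => by rw [hcoeff i (Finset.mem_range.1 hi)]]
  simp [hn.ne']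

/-- Checks that the residue class `x` of `X` modulo `bitPoly n P` has multiplicative order
`2 ^ n - 1`, given the list `l` of the prime divisors of `2 ^ n - 1`: the powers of `x` with
exponents `2 ^ n - 1` and `(2 ^ n - 1) / q` for `q` in `l` are computed. The hint `mu` is used for
Barrett reduction. -/
def primitiveCheck (n P mu : ℕ) (l : List ℕ) : Bool :=
  (0 < n) && (n ≤ 1024) && (2 ^ n ≤ P) && (P < 2 ^ (n + 1)) && (l.prod == 2 ^ n - 1) &&
    force (spread (n + 1) P) fun P' => force (spread (n + 1) mu) fun mu' =>
      force (mask n) fun m1 => force (mask (2 * n)) fun m2 =>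
        (powX n P' mu' m1 m2 (2 ^ n - 1) == 1) &&
          l.all fun q => force (powX n P' mu' m1 m2 ((2 ^ n - 1) / q)) fun r =>
            (r < slot ^ n) && (r != 1)

theorem charP_adjoinRoot (p : (ZMod 2)[X]) [Nontrivial (AdjoinRoot p)] :
    CharP (AdjoinRoot p) 2 :=
  charP_of_injective_algebraMap (algebraMap (ZMod 2) (AdjoinRoot p)).injective 2

theorem orderOf_root_of_primitiveCheck {n P mu : ℕ} {l : List ℕ} (hl : ∀ q ∈ l, q.Prime)
    (h : primitiveCheck n P mu l = true) :
    orderOf (AdjoinRoot.root (bitPoly n P)) = 2 ^ n - 1 := by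
  simp only [primitiveCheck, force_eq, Bool.and_eq_true, decide_eq_true_eq, beq_iff_eq,
    List.all_eq_true, bne_iff_ne] at h
  obtain ⟨⟨⟨⟨⟨hn, hn'⟩, h1⟩, h2⟩, hprod⟩, hN, hq⟩ := h
  have hdeg := degree_bitPoly h1 h2
  have : Nontrivial (AdjoinRoot (bitPoly n P)) :=
    AdjoinRoot.nontrivial _ (by rw [hdeg]; exact_mod_cast hn.ne')
  have := charP_adjoinRoot (bitPoly n P)
  set x := AdjoinRoot.root (bitPoly n P) with hx
  have hP : Encodes x (n + 1) (spread (n + 1) P) 0 := by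
    convert encodes_spread x h2
    have := map_bitEval (AdjoinRoot.mk (bitPoly n P)) X (n + 1) P
    rw [AdjoinRoot.mk_X] at this
    rw [hx, ← this]
    exact AdjoinRoot.mk_self.symm
  have h2n : 1 < 2 ^ n := Nat.one_lt_two_pow hn.ne'
  refine orderOf_eq_of_pow_and_pow_div_prime (by omega) ?_ ?_
  · have := encodes_powX (spread (n + 1) mu) hn hn' hP (2 ^ n - 1)
      (by rw [hN]; exact Nat.one_lt_pow hn.ne' (by norm_num))
    rw [hN] at this
    obtain ⟨c, -, h1, hy⟩ := this.of_lt (n := 1) hn (by norm_num)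
    rw [Finset.sum_range_one, pow_zero, mul_one] at h1 hy
    rw [hy, ← h1, Nat.cast_one]
  · intro q hqp hqd hpow
    have hql : q ∈ l := by
      rw [← hprod] at hqd
      obtain ⟨r, hr, hqr⟩ := (Prime.dvd_prod_iff hqp.prime).1 hqd
      rwa [(Nat.prime_dvd_prime_iff_eq hqp (hl r hr)).1 hqr]
    have := encodes_powX (spread (n + 1) mu) hn hn' hP _ (hq q hql).1
    rw [hpow] at this
    exact (hq q hql).2 (this.eq_one hdeg hn)

/-! ### Linear maps annihilated on a vector by a primitive polynomial -/

section
variable {n P : ℕ}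

theorem card_adjoinRoot_bitPoly (h1 : 2 ^ n ≤ P) (h2 : P < 2 ^ (n + 1)) :
    Nat.card (AdjoinRoot (bitPoly n P)) = 2 ^ n := by
  have hm := monic_bitPoly h1 h2
  have : Module.Finite (ZMod 2) (AdjoinRoot (bitPoly n P)) := hm.finite_adjoinRoot
  rw [Module.natCard_eq_pow_finrank (K := ZMod 2), (AdjoinRoot.powerBasis' hm).finrank,
    AdjoinRoot.powerBasis'_dim, natDegree_eq_of_degree_eq_some (degree_bitPoly h1 h2),
    Nat.card_zmod]

/-- The residue ring has `2 ^ n - 1` nonzero elements, and the powers of a root of this order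
exhaust them. In particular all of them are units, although `bitPoly n P` is not known to be
irreducible beforehand. -/
theorem exists_root_pow_eq (hn : 0 < n) (h1 : 2 ^ n ≤ P) (h2 : P < 2 ^ (n + 1))
    (ho : orderOf (AdjoinRoot.root (bitPoly n P)) = 2 ^ n - 1) :
    ∀ y : AdjoinRoot (bitPoly n P), y ≠ 0 → ∃ j, AdjoinRoot.root (bitPoly n P) ^ j = y := by
  have hc := card_adjoinRoot_bitPoly h1 h2
  set A := AdjoinRoot (bitPoly n P)
  set x : A := AdjoinRoot.root (bitPoly n P)
  intro y hy
  have : Finite A := Nat.finite_of_card_ne_zero (by rw [hc]; positivity)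
  have : Nontrivial A := ⟨y, 0, hy⟩
  have h2n : 1 < 2 ^ n := Nat.one_lt_two_pow hn.ne'
  have hx : IsUnit x := IsUnit.of_pow_eq_one (pow_orderOf_eq_one x) (by omega)
  let f : Fin (2 ^ n - 1) → {y : A // y ≠ 0} := fun i => ⟨x ^ (i : ℕ), (hx.pow _).ne_zero⟩
  have hf : Function.Injective f := fun i j hij => Fin.ext <|
    pow_injOn_Iio_orderOf (by simp [ho, x]) (by simp [ho, x]) (Subtype.ext_iff.1 hij)
  have hcard : Nat.card (Fin (2 ^ n - 1)) = Nat.card {y : A // y ≠ 0} := by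
    have := Fintype.ofFinite A
    classical
    rw [Nat.card_eq_fintype_card, Nat.card_eq_fintype_card, Fintype.card_subtype_compl,
      Fintype.card_subtype_eq, Fintype.card_fin, ← Nat.card_eq_fintype_card, hc]
  obtain ⟨i, hi⟩ := ((Nat.bijective_iff_injective_and_card f).2 ⟨hf, hcard⟩).2 ⟨y, hy⟩
  exact ⟨i, congrArg Subtype.val hi⟩

variable {V : Type*} [AddCommGroup V] [Module (ZMod 2) V] {T : Module.End (ZMod 2) V} {e : V}

/-- A polynomial that is not divisible by `bitPoly n P` is invertible modulo `bitPoly n P`, so it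
cannot annihilate `e`: the annihilator of `e` is generated by `bitPoly n P`. -/
theorem pow_apply_eq_self_iff (hn : 0 < n) (h1 : 2 ^ n ≤ P) (h2 : P < 2 ^ (n + 1))
    (ho : orderOf (AdjoinRoot.root (bitPoly n P)) = 2 ^ n - 1)
    (he : e ≠ 0) (hT : aeval T (bitPoly n P) e = 0) (t : ℕ) :
    (T ^ t) e = e ↔ 2 ^ n - 1 ∣ t := by
  have key (q : (ZMod 2)[X]) : aeval T q e = 0 ↔ AdjoinRoot.mk (bitPoly n P) q = 0 := by
    constructor
    · intro hq
      by_contra hne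
      obtain ⟨j, hj⟩ := exists_root_pow_eq hn h1 h2 ho _ hne
      -- the class of `q` is the `j`-th power of the root, of order dividing `2 ^ n - 1`
      have hinv : AdjoinRoot.mk (bitPoly n P) (X ^ (j * (2 ^ n - 2)) * q - 1) = 0 := by
        rw [map_sub, map_mul, ← hj, map_pow, AdjoinRoot.mk_X, ← pow_add, map_one, sub_eq_zero,
          ← orderOf_dvd_iff_pow_eq_one, ho]
        have h2n : 2 ≤ 2 ^ n := Nat.le_self_pow hn.ne' 2
        exact ⟨j, by rw [← Nat.mul_succ, mul_comm]; congr 1; omega⟩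
      rw [AdjoinRoot.mk_eq_zero] at hinv
      obtain ⟨r, hr⟩ := hinv
      have := congrArg (fun s => aeval T s e) hr
      simp only [map_sub, map_mul, mul_comm (bitPoly n P), LinearMap.sub_apply,
        Module.End.mul_apply, hq, hT, map_zero, map_one, Module.End.one_apply, zero_sub,
        neg_eq_zero] at this
      exact he this
    · rw [AdjoinRoot.mk_eq_zero]
      rintro ⟨r, rfl⟩
      rw [mul_comm, map_mul, Module.End.mul_apply, hT, map_zero]
  have := key (X ^ t - 1)
  rwa [map_sub, map_pow, aeval_X, map_one, LinearMap.sub_apply, Module.End.one_apply, sub_eq_zero,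
    map_sub, map_pow, map_one, AdjoinRoot.mk_X, sub_eq_zero, ← orderOf_dvd_iff_pow_eq_one, ho]
    at this
end

/-! ### Maps that permute the nonzero vectors in one cycle -/

/-- `f` fixes `0` and permutes the nonzero elements in a single cycle. -/
def IsFullCycle {V : Type*} [Zero V] (f : V → V) : Prop :=
  f 0 = 0 ∧ ∀ s : V, s ≠ 0 → f^[Nat.card V - 1] s = s ∧
    ∀ s' : V, s' ≠ 0 → ∃ t < Nat.card V - 1, f^[t] s = s'

/-- If the orbit of a single nonzero element has the length of the set of nonzero elements, it is
that whole set. -/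
theorem isFullCycle_of_iterate {V : Type*} [Zero V] [Finite V] {f : V → V} {e : V} (h0 : f 0 = 0)
    (he : e ≠ 0) (h : ∀ t, f^[t] e = e ↔ Nat.card V - 1 ∣ t) : IsFullCycle f := by
  classical
  have := Fintype.ofFinite V
  set N := Nat.card V - 1 with hN
  have hNpos : 0 < N := Nat.sub_pos_of_lt (Finite.one_lt_card_iff_nontrivial.2 ⟨e, 0, he⟩)
  have hz (t : ℕ) : f^[t] 0 = 0 := Function.iterate_fixed h0 t
  have hper (t : ℕ) : f^[t * N] e = e := (h _).2 (Dvd.intro_left _ rfl)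
  have hne (t : ℕ) : f^[t] e ≠ 0 := by
    intro ht
    have h1 := hper t
    obtain ⟨k, hk⟩ := Nat.exists_eq_add_of_le (Nat.le_mul_of_pos_right t hNpos)
    rw [hk, add_comm, Function.iterate_add_apply, ht, hz] at h1
    exact he h1.symm
  have hinj : ∀ i < N, ∀ j < N, i ≤ j → f^[i] e = f^[j] e → i = j := by
    intro i hi j hj hij heq
    -- `N - i + j` is a multiple of `N` in the interval from `N` to `2 * N - 1`
    have h1 : f^[N - i + j] e = e := by
      rw [Function.iterate_add_apply, ← heq, ← Function.iterate_add_apply,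
        Nat.sub_add_cancel hi.le]
      exact (h _).2 dvd_rfl
    obtain ⟨d, hd⟩ := (h _).1 h1
    have hd1 : d = 1 := by
      rcases d with _ | _ | d
      · omega
      · rfl
      · have : N * 2 ≤ N * (d + 1 + 1) := Nat.mul_le_mul_left _ (by omega)
        omega
    subst hd1
    omega
  let F : Fin N → {s : V // s ≠ 0} := fun i => ⟨f^[i] e, hne _⟩
  have hF : Function.Injective F := by
    intro i j hij
    have hij := Subtype.ext_iff.1 hij
    rcases le_total i j with hle | hle
    · exact Fin.ext (hinj i i.2 j j.2 hle hij)
    · exact Fin.ext (hinj j j.2 i i.2 hle hij.symm).symm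
  have hcard : Nat.card (Fin N) = Nat.card {s : V // s ≠ 0} := by
    rw [Nat.card_eq_fintype_card, Nat.card_eq_fintype_card, Fintype.card_subtype_compl,
      Fintype.card_subtype_eq, Fintype.card_fin, ← Nat.card_eq_fintype_card]
  have hsurj := ((Nat.bijective_iff_injective_and_card F).2 ⟨hF, hcard⟩).2
  refine ⟨h0, fun s hs => ?_⟩
  obtain ⟨i, hi⟩ := hsurj ⟨s, hs⟩
  replace hi : f^[i] e = s := congrArg Subtype.val hi
  refine ⟨?_, fun s' hs' => ?_⟩
  · rw [← hi, ← Function.iterate_add_apply, add_comm, Function.iterate_add_apply]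
    congr 1
    exact (h _).2 dvd_rfl
  · obtain ⟨j, hj⟩ := hsurj ⟨s', hs'⟩
    replace hj : f^[j] e = s' := congrArg Subtype.val hj
    have key : ∀ t, N ∣ t + i - j → j ≤ t + i → f^[t] s = s' := by
      rintro t ⟨d, hd⟩ hle
      rw [← hi, ← Function.iterate_add_apply, show t + i = j + d * N by rw [mul_comm]; omega,
        Function.iterate_add_apply, hper, hj]
    rcases le_or_gt (i : ℕ) j with hle | hlt
    · exact ⟨j - i, by omega, key _ (by simp [Nat.sub_add_cancel hle]) (by omega)⟩
    · exact ⟨N - i + j, by omega, key _ ⟨1, by omega⟩ (by omega)⟩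

/-! ### Periods of balanced functions along a full cycle -/

theorem periodic_gcd {α : Type*} {u : ℕ → α} {p q : ℕ} (hp : Function.Periodic u p)
    (hq : Function.Periodic u q) : Function.Periodic u (p.gcd q) := by
  intro t
  rcases Nat.lt_or_ge (p.gcd q) q with h | h
  · obtain ⟨m, -, hm⟩ := Nat.exists_mul_mod_eq_gcd h
    rw [← hm, ← hq.nat_mul (p * m / q), add_assoc, Nat.cast_id, mul_comm (p * m / q),
      Nat.mod_add_div, mul_comm]
    exact hp.nat_mul m t
  · rcases Nat.eq_zero_or_pos q with rfl | hq0
    · rw [Nat.gcd_zero_right, hp]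
    · rw [(Nat.gcd_le_right p hq0).antisymm h, hq]

theorem sum_range_mul_of_periodic {u : ℕ → ℕ} {g : ℕ} (hu : Function.Periodic u g) (k : ℕ) :
    ∑ t ∈ Finset.range (g * k), u t = k * ∑ t ∈ Finset.range g, u t := by
  induction k with
  | zero => simp
  | succ k ih =>
    rw [Nat.mul_succ, Finset.sum_range_add, ih, Nat.succ_mul]
    congr 1
    refine Finset.sum_congr rfl fun i _ => ?_
    rw [add_comm, mul_comm]
    exact hu.nat_mul k i

/-- Along a full cycle, a function `b` that vanishes at `0` and takes both values equally often
takes the value `true` exactly `2 ^ (n - 1)` times. If the sequence had a smaller period, the odd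
number `2 ^ n - 1` would have a divisor `k > 1` such that the number of ones is a multiple of `k`.
-/
theorem IsFullCycle.hasPeriod {V : Type*} [Fintype V] [Zero V] {f : V → V} (hf : IsFullCycle f)
    {n : ℕ} (hV : Nat.card V = 2 ^ n) {b : V → Bool} (hb0 : b 0 = false)
    (hb : 2 * (Finset.univ.filter fun s => b s = true).card = 2 ^ n) {s : V} (hs : s ≠ 0) :
    HasPeriod (fun t => b (f^[t] s)) (2 ^ n - 1) := by
  classical
  set N := 2 ^ n - 1 with hN
  obtain ⟨hper, horb⟩ := hf.2 s hs
  rw [hV] at hper horb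
  have h2n : 1 < 2 ^ n := hV ▸ Finite.one_lt_card_iff_nontrivial.2 ⟨s, 0, hs⟩
  set u : ℕ → Bool := fun t => b (f^[t] s) with hu
  have huN : Function.Periodic u N := fun t => by
    rw [hu]
    dsimp only
    rw [Function.iterate_add_apply, hper]
  -- the state runs through all nonzero values, so the ones are counted by `hb`
  have hcount : 2 * ∑ t ∈ Finset.range N, (u t).toNat = 2 ^ n := by
    have himg : (Finset.range N).image (fun t => f^[t] s) = Finset.univ.erase 0 := by
      refine (Finset.eq_of_subset_of_card_le (fun s' hs' => ?_) ?_).symm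
      · obtain ⟨t, ht, h⟩ := horb s' (Finset.ne_of_mem_erase hs')
        exact Finset.mem_image.2 ⟨t, Finset.mem_range.2 ht, h⟩
      · rw [Finset.card_erase_of_mem (Finset.mem_univ _), Finset.card_univ,
          ← Nat.card_eq_fintype_card, hV, ← hN]
        exact Finset.card_image_le.trans (Finset.card_range N).le
    have hinj : Set.InjOn (fun t => f^[t] s) (Finset.range N) := by
      rw [← Finset.card_image_iff, himg, Finset.card_erase_of_mem (Finset.mem_univ _),
        Finset.card_univ, ← Nat.card_eq_fintype_card, hV, Finset.card_range]
    have : ∑ t ∈ Finset.range N, (u t).toNat = ∑ v ∈ Finset.univ.erase (0 : V), (b v).toNat := by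
      rw [← himg, Finset.sum_image hinj]
    rw [this, ← hb, Finset.card_filter, ← Finset.add_sum_erase _ _ (Finset.mem_univ (0 : V)), hb0]
    simp [Bool.toNat, Bool.cond_eq_ite]
  refine ⟨⟨by omega, huN⟩, fun q ⟨hq0, hq⟩ => ?_⟩
  -- `k` divides both the number of ones in `N` terms, hence `2 ^ n`, and `N = 2 ^ n - 1`
  have hg := periodic_gcd hq huN
  obtain ⟨k, hk⟩ := Nat.gcd_dvd_right q N
  have hgu : Function.Periodic (fun t => (u t).toNat) (q.gcd N) := fun t => by
    dsimp only; rw [hg t]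
  have hk2 : k ∣ 2 ^ n := by
    rw [← hcount, hk, sum_range_mul_of_periodic hgu k]
    exact ⟨2 * ∑ t ∈ Finset.range (q.gcd N), (u t).toNat, by ring⟩
  have hk1 : k ∣ 1 := by
    have h1 : k ∣ N := ⟨_, by rw [mul_comm]; exact hk⟩
    have := Nat.dvd_sub hk2 h1
    rwa [hN, Nat.sub_sub_self (by omega)] at this
  rw [Nat.dvd_one.1 hk1, mul_one] at hk
  exact hk ▸ Nat.gcd_le_left N hq0

/-- If the output is a bijective function of one word when the others are fixed, each of its bits
takes both values equally often: changing that word so that exactly bit `i` of the output flips is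
an injective map on states. -/
theorem card_getLsb_of_bijective {w k : ℕ} (out : State w k → BitVec w) (p : Fin k)
    (hp : ∀ s : State w k, Function.Bijective fun x => out (Function.update s p x)) (i : Fin w) :
    2 * (Finset.univ.filter fun s => (out s).getLsb i = true).card = 2 ^ (k * w) := by
  classical
  choose y hy using fun s : State w k => (hp s).2 (out s ^^^ BitVec.twoPow w i)
  set flip : State w k → State w k := fun s => Function.update s p (y s) with hflip
  have hout (s : State w k) : out (flip s) = out s ^^^ BitVec.twoPow w i := hy s
  have hbit (s : State w k) : (out (flip s)).getLsb i = !(out s).getLsb i := by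
    rw [hout]
    change (out s ^^^ BitVec.twoPow w i).getLsbD i = !(out s).getLsbD i
    simp
  have hinj : Function.Injective flip := by
    intro s s' h
    have hoff : ∀ j ≠ p, s j = s' j := fun j hj => by
      simpa [hflip, hj] using congrFun h j
    have hs' : Function.update s p (s' p) = s' := by
      ext1 j
      rcases eq_or_ne j p with rfl | hj
      · simp
      · simp [hj, hoff j hj]
    have ho : out s = out s' := by
      have := hout s
      rw [h, hout] at this
      exact (BitVec.xor_left_inj _).1 this.symm
    have := (hp s).1 (a₁ := s p) (a₂ := s' p) (by simpa [hs'] using ho)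
    rw [← hs', ← this, Function.update_eq_self]
  have h1 : (Finset.univ.filter fun s => (out s).getLsb i = true).card =
      (Finset.univ.filter fun s => ¬(out s).getLsb i = true).card := by
    refine le_antisymm ?_ ?_ <;>
    · refine Finset.card_le_card_of_injOn flip (fun s hs => ?_) hinj.injOn
      simp only [Finset.coe_filter, Finset.mem_univ, true_and, Set.mem_ofPred_eq, hbit] at hs ⊢
      simpa using hs
  have h2 := Finset.card_filter_add_card_filter_not (s := (Finset.univ : Finset (State w k)))
    (fun s => (out s).getLsb i = true)
  rw [two_mul]
  nth_rw 2 [h1]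
  rw [h2, Finset.card_univ]
  simp [pow_mul', Fintype.card_congr (BitVec.equivFin (m := w)).toEquiv]

/-! ### States as a vector space over the field with two elements -/

/-- A copy of `State w k` whose addition is the bitwise exclusive or. A separate structure is needed
because the pointwise addition of `State w k` is modulo `2 ^ w`. -/
@[ext]
structure XorState (w k : ℕ) where
  toState : State w k

namespace XorState
variable {w k : ℕ}

instance : Zero (XorState w k) := ⟨⟨0⟩⟩
instance : Add (XorState w k) := ⟨fun s s' => ⟨fun j => s.toState j ^^^ s'.toState j⟩⟩
instance : Neg (XorState w k) := ⟨fun s => s⟩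

theorem toState_add (s s' : XorState w k) :
    (s + s').toState = fun j => s.toState j ^^^ s'.toState j := rfl

theorem add_self (s : XorState w k) : s + s = 0 :=
  XorState.ext (funext fun _ => BitVec.xor_self)

instance : AddCommGroup (XorState w k) where
  add_assoc _ _ _ := XorState.ext (funext fun _ => BitVec.xor_assoc _ _ _)
  zero_add _ := XorState.ext (funext fun _ => BitVec.zero_xor)
  add_zero _ := XorState.ext (funext fun _ => BitVec.xor_zero)
  neg_add_cancel := add_self
  add_comm _ _ := XorState.ext (funext fun _ => BitVec.xor_comm _ _)
  nsmul := nsmulRec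
  zsmul := zsmulRec

instance : Module (ZMod 2) (XorState w k) :=
  AddCommGroup.zmodModule fun s => by rw [two_nsmul, add_self]

end XorState

/-- The state whose words are the digits of `a` in base `2 ^ w`. -/
def unpack (w k a : ℕ) : State w k := fun j => BitVec.ofNat w (a >>> (w * j))

/-- The number whose digits in base `2 ^ w` are the words of `s`. -/
def pack {w k : ℕ} (s : State w k) : ℕ :=
  (List.ofFn s).foldr (fun x a => x.toNat + a <<< w) 0

theorem unpack_pack {w k : ℕ} (s : State w k) : unpack w k (pack s) = s := by
  have key : ∀ (l : List (BitVec w)) (j : ℕ) (hj : j < l.length),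
      BitVec.ofNat w (l.foldr (fun x a => x.toNat + a <<< w) 0 >>> (w * j)) = l[j] := by
    intro l
    induction l with
    | nil => simp
    | cons x l ih =>
      rintro (_ | j) hj
      · apply BitVec.eq_of_toNat_eq
        simp [Nat.shiftLeft_eq, Nat.mod_eq_of_lt x.isLt]
      · rw [List.foldr_cons, Nat.mul_succ, add_comm (w * j), Nat.shiftRight_add,
          Nat.shiftRight_eq_div_pow _ w, Nat.shiftLeft_eq,
          Nat.add_mul_div_right _ _ (by positivity),
          Nat.div_eq_of_lt x.isLt, zero_add]
        exact ih j (by simpa using hj)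
  funext j
  rw [unpack, pack, key _ j (by simp)]
  simp

theorem unpack_xor (w k a b : ℕ) :
    unpack w k (a ^^^ b) = fun j => unpack w k a j ^^^ unpack w k b j := by
  funext j
  rw [unpack, unpack, unpack, Nat.shiftRight_xor_distrib, BitVec.ofNat_xor]

theorem unpack_zero (w k : ℕ) : unpack w k 0 = 0 := by
  funext j
  simp [unpack]

/-- Checks, by Horner's rule on packed states, that the polynomial with coefficients the bits of
`P`, evaluated at the linear map `f`, annihilates the state whose only nonzero bit is bit `0` of
word `0`. -/
def annihilatesCheck {w k : ℕ} (f : State w k → State w k) (P : ℕ) : Bool :=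
  bitLoop (fun a b => pack (f (unpack w k a)) ^^^ b.toNat) P (k * w + 1) 0 == 0

/-- `f` is additive with respect to the bitwise exclusive or. -/
def XorLinear {w k : ℕ} (f : State w k → State w k) : Prop :=
  ∀ s s' : State w k, f (fun j => s j ^^^ s' j) = fun j => f s j ^^^ f s' j

theorem card_state (w k : ℕ) : Nat.card (State w k) = 2 ^ (k * w) := by
  rw [Nat.card_fun, Nat.card_congr (BitVec.equivFin (m := w)).toEquiv, Nat.card_fin,
    Nat.card_fin, pow_mul']

namespace XorLinear

variable {w k : ℕ} {f : State w k → State w k}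

/-- A linear engine as an endomorphism of the vector space of states. -/
def toEnd (hf : XorLinear f) : Module.End (ZMod 2) (XorState w k) :=
  AddMonoidHom.toZModLinearMap 2 <|
    AddMonoidHom.mk' (fun s => ⟨f s.toState⟩) fun s s' => XorState.ext (hf s.toState s'.toState)

theorem toEnd_apply (hf : XorLinear f) (s : State w k) : hf.toEnd ⟨s⟩ = ⟨f s⟩ := rfl

theorem toEnd_pow_apply (hf : XorLinear f) (t : ℕ) (s : State w k) :
    (hf.toEnd ^ t) ⟨s⟩ = ⟨f^[t] s⟩ := by
  induction t with
  | zero => rfl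
  | succ t ih => rw [pow_succ', Module.End.mul_apply, ih, toEnd_apply, Function.iterate_succ_apply']

theorem map_zero (hf : XorLinear f) : f 0 = 0 :=
  congrArg XorState.toState (LinearMap.map_zero hf.toEnd)

theorem aeval_bitPoly_apply (hf : XorLinear f) {P : ℕ} (hP : P < 2 ^ (k * w + 1))
    (ha : annihilatesCheck f P = true) :
    aeval hf.toEnd (bitPoly (k * w) P) ⟨unpack w k 1⟩ = 0 := by
  have hloop := bitLoop_eq_of_horner (fun a => (⟨unpack w k a⟩ : XorState w k))
    (fun m t => bitEval hf.toEnd m t ⟨unpack w k 1⟩)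
    (step := fun a b => pack (f (unpack w k a)) ^^^ b.toNat)
    (by rw [unpack_zero, bitEval_zero]; rfl)
    (fun m => by simp only [bitEval_zero])
    (fun m t a b hab => by
      rw [bitEval_succ, LinearMap.add_apply, Module.End.mul_apply, ← hab, toEnd_apply]
      have hb : ((b.toNat : ℕ) : Module.End (ZMod 2) (XorState w k)) ⟨unpack w k 1⟩ =
          ⟨unpack w k b.toNat⟩ := by
        cases b
        · rw [Bool.toNat_false, Nat.cast_zero, unpack_zero]; rfl
        · rw [Bool.toNat_true, Nat.cast_one]; rfl
      rw [hb]
      refine XorState.ext ?_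
      rw [XorState.toState_add, unpack_xor, unpack_pack]) hP
  rw [annihilatesCheck, beq_iff_eq] at ha
  rw [bitPoly, map_bitEval, aeval_X, ← hloop, ha, unpack_zero]
  rfl

theorem isFullCycle (hf : XorLinear f) {P mu : ℕ} {l : List ℕ} (hl : ∀ q ∈ l, q.Prime)
    (h : primitiveCheck (k * w) P mu l = true) (ha : annihilatesCheck f P = true) :
    IsFullCycle f := by
  have ho := orderOf_root_of_primitiveCheck hl h
  simp only [primitiveCheck, Bool.and_eq_true, decide_eq_true_eq] at h
  obtain ⟨⟨⟨⟨⟨hn, -⟩, h1⟩, h2⟩, -⟩, -⟩ := h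
  have hw : 0 < w := Nat.pos_of_mul_pos_left hn
  have hk : 0 < k := Nat.pos_of_mul_pos_right hn
  have he : unpack w k 1 ≠ 0 := by
    intro h0
    have := congrArg BitVec.toNat (congrFun h0 ⟨0, hk⟩)
    simp [unpack, Nat.mod_eq_of_lt (Nat.one_lt_two_pow hw.ne')] at this
  have he' : (⟨unpack w k 1⟩ : XorState w k) ≠ 0 := fun h0 =>
    he (congrArg XorState.toState h0)
  refine isFullCycle_of_iterate hf.map_zero he fun t => ?_
  rw [card_state, ← pow_apply_eq_self_iff hn h1 h2 ho he' (hf.aeval_bitPoly_apply h2 ha) t,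
    toEnd_pow_apply, XorState.mk.injEq]

end XorLinear

/-! ### Linearity of the engines -/

theorem rotateLeft_xor {w : ℕ} (x y : BitVec w) (r : ℕ) :
    (x ^^^ y).rotateLeft r = x.rotateLeft r ^^^ y.rotateLeft r := by
  ext i hi
  simp only [BitVec.getElem_rotateLeft, BitVec.getElem_xor]
  split_ifs <;> rfl

theorem xorLinear_xoroshiro {w m : ℕ} (a b c : ℕ) :
    XorLinear (xoroshiro a b c : State w (m + 2) → State w (m + 2)) := by
  intro s s'
  funext j
  simp only [xoroshiro]
  split_ifs
  · rw [← rotateLeft_xor]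
    congr 1
    ac_rfl
  · simp only [rotateLeft_xor, BitVec.shiftLeft_xor_distrib]
    ac_rfl
  · rfl

theorem xorLinear_xoshiro4 {w : ℕ} (a b : ℕ) :
    XorLinear (xoshiro4 a b : State w 4 → State w 4) := by
  intro s s'
  funext j
  fin_cases j <;> simp [xoshiro4, rotateLeft_xor, BitVec.shiftLeft_xor_distrib] <;> ac_rfl

theorem xorLinear_xoshiro8 {w : ℕ} (a b : ℕ) :
    XorLinear (xoshiro8 a b : State w 8 → State w 8) := by
  intro s s'
  funext j
  fin_cases j <;> simp [xoshiro8, rotateLeft_xor, BitVec.shiftLeft_xor_distrib] <;> ac_rfl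

/-! ### The engines are full cycles -/

/-- The prime divisors of the Fermat numbers `2 ^ 2 ^ i + 1` for `i < 10`, listed by increasing `i`.
The number `2 ^ 2 ^ m - 1` is the product of the Fermat numbers with `i < m`, so its prime divisors
form an initial segment of the list. -/
def fermatFactors : List ℕ :=
  [3, 5, 17, 257, 65537, 641, 6700417, 274177, 67280421310721, 59649589127497217,
   5704689200685129054721, 1238926361552897,
   93461639715357977769163558199606896584051237541638188580280321, 2424833,
   7455602825647884208337395736200454918783366342657,
   741640062627530801524787141901937474059940781097519023905821316144415759504705008092818711693940737]

theorem prime_of_mem_take_fermatFactors {m q : ℕ} (hq : q ∈ fermatFactors.take m) : q.Prime := by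
  have hmem : ∀ q ∈ fermatFactors, ∃ c ∈ prattCertificates, c.1 = q := by decide +kernel
  obtain ⟨c, hc, rfl⟩ := hmem q (List.mem_of_mem_take hq)
  exact prime_of_prattCheck prattCheck_prattCertificates c hc

theorem isFullCycle_xoroshiro128 : IsFullCycle (xoroshiro 24 16 37 : State 64 2 → State 64 2) :=
  (xorLinear_xoroshiro 24 16 37).isFullCycle
    (P := 0x10008828e513b43d5095b8f76579aa001)
    (mu := 0x1000882ce131d909672f817c07cfcaeae)
    (fun _ => prime_of_mem_take_fermatFactors (m := 9)) (by decide +kernel) (by decide +kernel)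

theorem isFullCycle_xoroshiro128_plusPlus :
    IsFullCycle (xoroshiro 49 21 28 : State 64 2 → State 64 2) :=
  (xorLinear_xoroshiro 49 21 28).isFullCycle
    (P := 0x10031bcf2f855d6e58dae70779760b081)
    (mu := 0x10031b9f34a669229e33aabfc3e68ea10)
    (fun _ => prime_of_mem_take_fermatFactors (m := 9)) (by decide +kernel) (by decide +kernel)

theorem isFullCycle_xoshiro256 : IsFullCycle (xoshiro4 17 45 : State 64 4 → State 64 4) :=
  (xorLinear_xoshiro4 17 45).isFullCycle
    (P := 0x10003c03c3f3ecb1904b4edcf26259f850280002bcefd1a5e9d116f2bb0f0f001)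
    (mu := 0x10003c0396f32c298132b61f2778b69e1aa1297eadd5e76b793a906d956fbc489)
    (fun _ => prime_of_mem_take_fermatFactors (m := 11)) (by decide +kernel) (by decide +kernel)

theorem isFullCycle_xoshiro512 : IsFullCycle (xoshiro8 11 21 : State 64 8 → State 64 8) :=
  (xorLinear_xoshiro8 11 21).isFullCycle
    (P := 0x10000500055d8b77f8f2d27268ce4b20b51ba7c47edc758adf11eef832e32518f7a67058e7bbab6f0f05e63fca6d7b7817fdc78d886f00c63cf3cff0c00000001)
    (mu := 0x10000500044d8b22f9a3520a35a819a8d8ca188e5909bf4a3730d0b727ddf2fd0db1800ed12b6da5bf81252241d6275ec585456dff6dbd103eb7ff93e81c990bd)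
    (fun _ => prime_of_mem_take_fermatFactors (m := 13)) (by decide +kernel) (by decide +kernel)

theorem isFullCycle_xoroshiro1024 : IsFullCycle (xoroshiro 25 27 36 : State 64 16 → State 64 16) :=
  (xorLinear_xoroshiro 25 27 36).isFullCycle
    (P := 0x10000000000800081008040a0580158a1580d080b44b606a20710704d05683d63a46134526b83adc5abaf68c5fc3a0e4a6ca140c61889cddd955c84e105f609979bf0b669abd100f8a1d3b6ee079a7cc63689b412ef70de4829d373b5c5ed34597550223f68f98cac17d5100a20a0350eb73e379d035a06dd5cfeb8cc48ddb211)
    (mu := 0x10000000000800081008000a058011880582d080b543e142350f030ed580150c6d84cad798fa07dac9c4df18963cada7170cab29b6aaa9ee999cf2772341576eea0cab9995268ba0b8a534378a53c5e8d30ce6f06737215b95d289a01da26ce9cc5f2154f19c4188bfe85542df24f5def4141a8956d33aea696a2791460ce7790)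
    (fun _ => prime_of_mem_take_fermatFactors (m := 16)) (by decide +kernel) (by decide +kernel)

theorem isFullCycle_xoroshiro64 : IsFullCycle (xoroshiro 26 9 13 : State 32 2 → State 32 2) :=
  (xorLinear_xoroshiro 26 9 13).isFullCycle
    (P := 0x1053be9da6e2286c1)
    (mu := 0x1052abb0eebf7c3c2)
    (fun _ => prime_of_mem_take_fermatFactors (m := 7)) (by decide +kernel) (by decide +kernel)

theorem isFullCycle_xoshiro128 : IsFullCycle (xoshiro4 9 11 : State 32 4 → State 32 4) :=
  (xorLinear_xoshiro4 9 11).isFullCycle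
    (P := 0x100fc65a2006254b11b489db6de18fc01)
    (mu := 0x100fc30c1e77fb1ccff70c17d85cb2557)
    (fun _ => prime_of_mem_take_fermatFactors (m := 9)) (by decide +kernel) (by decide +kernel)

/-! ### Scramblers -/

/-- The output vanishes at the zero state and is a bijective function of one of the words when the
other words are fixed. -/
structure IsBalanced {w k : ℕ} (out : State w k → BitVec w) : Prop where
  map_zero : out 0 = 0
  exists_bijective : ∃ p, ∀ s : State w k, Function.Bijective fun x => out (Function.update s p x)

/-- From every nonzero state, each output bit has the period `2 ^ n - 1`, where `n` is the number of
bits of state. -/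
def Generator.HasFullPeriodBits (g : Generator) : Prop :=
  ∀ seed : State g.w g.k, seed ≠ 0 → ∀ i, HasPeriod (g.bitSeq i seed) (2 ^ g.stateBits - 1)

theorem IsFullCycle.hasFullPeriodBits {w k : ℕ} {f : State w k → State w k} (hf : IsFullCycle f)
    {out : State w k → BitVec w} (ho : IsBalanced out) :
    (⟨w, k, f, out⟩ : Generator).HasFullPeriodBits := by
  intro seed hs i
  obtain ⟨h0, p, hp⟩ := ho
  refine hf.hasPeriod (card_state w k) (b := fun s => (out s).getLsb i) ?_
    (card_getLsb_of_bijective out p hp i) hs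
  change (out 0).getLsbD i = false
  rw [h0]
  exact BitVec.getLsbD_zero

theorem isBalanced_of_injective {w k : ℕ} {out : State w k → BitVec w} (h0 : out 0 = 0) (p : Fin k)
    (hp : ∀ s : State w k, Function.Injective fun x => out (Function.update s p x)) :
    IsBalanced out :=
  ⟨h0, p, fun s => Finite.injective_iff_bijective.1 (hp s)⟩

theorem rotateLeft_injective {w : ℕ} (r : ℕ) :
    Function.Injective fun x : BitVec w => x.rotateLeft r := by
  intro x y h
  have key {j : ℕ} (hj : j < w) : (x.rotateLeft r)[j] = (y.rotateLeft r)[j] := by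
    rw [show x.rotateLeft r = y.rotateLeft r from h]
  ext i hi
  have hr : r % w < w := Nat.mod_lt _ (by omega)
  rcases lt_or_ge (i + r % w) w with hlt | hge
  · simpa [BitVec.getElem_rotateLeft] using key hlt
  · have := key (j := i + r % w - w) (by omega)
    rw [BitVec.getElem_rotateLeft, BitVec.getElem_rotateLeft, dif_pos (by omega),
      dif_pos (by omega)] at this
    convert this using 2 <;> omega

theorem zero_rotateLeft {w : ℕ} (r : ℕ) : (0#w).rotateLeft r = 0#w := by
  rw [← BitVec.xor_self (x := 0#w), rotateLeft_xor]
  simp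

theorem mul_right_injective_of_mul_eq_one {w : ℕ} {S U : BitVec w} (h : S * U = 1) :
    Function.Injective fun x : BitVec w => x * S := by
  intro x y hxy
  simpa [mul_assoc, h] using congrArg (· * U) hxy

variable {w k : ℕ}

theorem isBalanced_word (j : Fin k) : IsBalanced (word j : State w k → BitVec w) :=
  isBalanced_of_injective rfl j fun s x y h => by simpa [word] using h

theorem isBalanced_plus {p q : Fin k} (hpq : p ≠ q) :
    IsBalanced (plus p q : State w k → BitVec w) :=
  isBalanced_of_injective (by simp [plus]) p fun s x y h => by
    simpa [plus, Function.update_of_ne hpq.symm] using h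

theorem isBalanced_star (p : Fin k) {S U : BitVec w} (hS : S * U = 1) :
    IsBalanced (star p S : State w k → BitVec w) :=
  isBalanced_of_injective (by simp [star]) p fun s x y h =>
    mul_right_injective_of_mul_eq_one hS (by simpa [star] using h)

theorem isBalanced_plusPlus {p q : Fin k} (hpq : p ≠ q) (r : ℕ) :
    IsBalanced (plusPlus p q r : State w k → BitVec w) :=
  isBalanced_of_injective (by simp [plusPlus, zero_rotateLeft]) q fun s x y h => by
    have := rotateLeft_injective r (by simpa [plusPlus, Function.update_of_ne hpq] using h)
    simpa using this

theorem isBalanced_starStar (p : Fin k) {S U : BitVec w} (hS : S * U = 1) (r : ℕ)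
    {T T' : BitVec w} (hT : T * T' = 1) :
    IsBalanced (starStar p S r T : State w k → BitVec w) :=
  isBalanced_of_injective (by simp [starStar, zero_rotateLeft]) p fun s x y h =>
    mul_right_injective_of_mul_eq_one hS <| rotateLeft_injective r <|
      mul_right_injective_of_mul_eq_one hT (by simpa [starStar] using h)

/-! ### The tables -/

theorem hasFullPeriodBits_of_table64 {g : Generator} (hg : Table64 g) :
    g.HasFullPeriodBits := by
  have h5 : (5 : BitVec 64) * 0xcccccccccccccccd = 1 := by decide +kernel
  have h9 : (9 : BitVec 64) * 0x8e38e38e38e38e39 = 1 := by decide +kernel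
  have hS : (0x9e3779b97f4a7c13 : BitVec 64) * 0x3fbd78d0fbf0ae1b = 1 := by decide +kernel
  cases hg with
  | xoroshiro128 j => exact isFullCycle_xoroshiro128.hasFullPeriodBits (isBalanced_word j)
  | xoshiro256 j => exact isFullCycle_xoshiro256.hasFullPeriodBits (isBalanced_word j)
  | xoshiro512 j => exact isFullCycle_xoshiro512.hasFullPeriodBits (isBalanced_word j)
  | xoroshiro1024 j => exact isFullCycle_xoroshiro1024.hasFullPeriodBits (isBalanced_word j)
  | xoroshiro128plus =>
    exact isFullCycle_xoroshiro128.hasFullPeriodBits (isBalanced_plus (by decide))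
  | xoshiro256plus =>
    exact isFullCycle_xoshiro256.hasFullPeriodBits (isBalanced_plus (by decide))
  | xoshiro512plus =>
    exact isFullCycle_xoshiro512.hasFullPeriodBits (isBalanced_plus (by decide))
  | xoroshiro1024plus =>
    exact isFullCycle_xoroshiro1024.hasFullPeriodBits (isBalanced_plus (by decide))
  | xoroshiro128star => exact isFullCycle_xoroshiro128.hasFullPeriodBits (isBalanced_star 0 hS)
  | xoroshiro1024star =>
    exact isFullCycle_xoroshiro1024.hasFullPeriodBits (isBalanced_star 0 hS)
  | xoroshiro128plusPlus =>
    exact isFullCycle_xoroshiro128_plusPlus.hasFullPeriodBits (isBalanced_plusPlus (by decide) 17)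
  | xoshiro256plusPlus =>
    exact isFullCycle_xoshiro256.hasFullPeriodBits (isBalanced_plusPlus (by decide) 23)
  | xoshiro512plusPlus =>
    exact isFullCycle_xoshiro512.hasFullPeriodBits (isBalanced_plusPlus (by decide) 17)
  | xoroshiro1024plusPlus =>
    exact isFullCycle_xoroshiro1024.hasFullPeriodBits (isBalanced_plusPlus (by decide) 23)
  | xoroshiro128starStar =>
    exact isFullCycle_xoroshiro128.hasFullPeriodBits (isBalanced_starStar 0 h5 7 h9)
  | xoshiro256starStar =>
    exact isFullCycle_xoshiro256.hasFullPeriodBits (isBalanced_starStar 1 h5 7 h9)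
  | xoshiro512starStar =>
    exact isFullCycle_xoshiro512.hasFullPeriodBits (isBalanced_starStar 1 h5 7 h9)
  | xoroshiro1024starStar =>
    exact isFullCycle_xoroshiro1024.hasFullPeriodBits (isBalanced_starStar 0 h5 7 h9)

theorem hasFullPeriodBits_of_table32 {g : Generator} (hg : Table32 g) :
    g.HasFullPeriodBits := by
  have h5 : (5 : BitVec 32) * 0xcccccccd = 1 := by decide +kernel
  have h9 : (9 : BitVec 32) * 0x38e38e39 = 1 := by decide +kernel
  have hS : (0x9E3779BB : BitVec 32) * 0xbe736373 = 1 := by decide +kernel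
  cases hg with
  | xoroshiro64 j => exact isFullCycle_xoroshiro64.hasFullPeriodBits (isBalanced_word j)
  | xoshiro128 j => exact isFullCycle_xoshiro128.hasFullPeriodBits (isBalanced_word j)
  | xoroshiro64star => exact isFullCycle_xoroshiro64.hasFullPeriodBits (isBalanced_star 0 hS)
  | xoshiro128plus =>
    exact isFullCycle_xoshiro128.hasFullPeriodBits (isBalanced_plus (by decide))
  | xoshiro128plusPlus =>
    exact isFullCycle_xoshiro128.hasFullPeriodBits (isBalanced_plusPlus (by decide) 7)
  | xoroshiro64starStar =>
    exact isFullCycle_xoroshiro64.hasFullPeriodBits (isBalanced_starStar 0 hS 5 h5)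
  | xoshiro128starStar =>
    exact isFullCycle_xoshiro128.hasFullPeriodBits (isBalanced_starStar 1 h5 7 h9)

end Scrambled

theorem mainTheorem8 (g : Scrambled.Generator)
    (hg : Scrambled.Table64 g ∨ Scrambled.Table32 g)
    (seed : Scrambled.State g.w g.k) (hseed : seed ≠ 0) (i : Fin g.w) :
    Scrambled.HasPeriod (g.bitSeq i seed) (2 ^ g.stateBits - 1) := by
  rcases hg with hg | hg
  exacts [Scrambled.hasFullPeriodBits_of_table64 hg seed hseed i,
    Scrambled.hasFullPeriodBits_of_table32 hg seed hseed i]
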